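/- Let $k\ge 1$. A perfect matching of the complete graph $K_{2k}$ is a set of pairwise vertex-disjoint edges covering all $2k$ vertices. Call a family of perfect matchings of $K_{2k}$ intersecting if any two of its members have an edge in common, and for an edge $e$ of $K_{2k}$ let $S_e$ be the family of all perfect matchings of $K_{2k}$ that contain $e$. Write $(2k-3)!!=(2k-3)(2k-5)\cdots 1$, with $(-1)!!=1$. Then every intersecting family $\mathcal F$ of perfect matchings of $K_{2k}$ satisfies $|\mathcal F|\le (2k-3)!!$, and a family $\mathcal F$ is intersecting with $|\mathcal F|=(2k-3)!!$ if and only if $\mathcal F=S_e$ for some edge $e$ of $K_{2k}$. Equivalently, let $M(2k)$ be the perfect matching derangement graph, whose vertices are the perfect matchings of $K_{2k}$, two of them being adjacent if and only if they have no edge in common, and call a set of pairwise non-adjacent vertices a coclique. Then the maximum size of a coclique of $M(2k)$ is $(2k-3)!!$, and the cocliques of maximum size are exactly the families $S_e$, where $e$ is an edge of $K_{2k}$. -/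

import Mathlib

open scoped Nat

namespace MatchingEKR

/-- The perfect matchings of the complete graph `K_{2k}` on the vertex set `Fin (2 * k)`. -/
abbrev PM (k : ℕ) : Type :=
  {M : (⊤ : SimpleGraph (Fin (2 * k))).Subgraph // M.IsPerfectMatching}

/-- Two perfect matchings intersect if they contain a common edge. -/
def Intersect {k : ℕ} (M N : PM k) : Prop :=
  ∃ e, e ∈ M.1.edgeSet ∧ e ∈ N.1.edgeSet

/-- A family of perfect matchings is intersecting if any two of its members share an edge. -/
def IsIntersecting {k : ℕ} (F : Set (PM k)) : Prop :=
  F.Pairwise Intersect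

/-- `S_e`: all perfect matchings that contain the edge `e`. -/
def canonical {k : ℕ} (e : Sym2 (Fin (2 * k))) : Set (PM k) :=
  {M | e ∈ M.1.edgeSet}

/-- The perfect matching derangement graph `M(2k)`: its vertices are the perfect matchings of
`K_{2k}`, and two of them are adjacent iff they have no edge in common. The clause `M ≠ N` is
automatic for `1 ≤ k`; it only rules out a loop at the empty matching when `k = 0`. -/
def derangementGraph (k : ℕ) : SimpleGraph (PM k) where
  Adj M N := M ≠ N ∧ ¬ Intersect M N
  symm := ⟨fun _ _ h => ⟨h.1.symm, fun ⟨e, h₁, h₂⟩ => h.2 ⟨e, h₂, h₁⟩⟩⟩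
  loopless := ⟨fun _ h => h.1 rfl⟩

end MatchingEKR

/-!
Let `𝒜` be an intersecting family of perfect matchings with no common edge, and let `s ≥ 2` be the
smallest size of a set of edges meeting every member. If `T` has fewer than `s` edges, some `B ∈ 𝒜`
is disjoint from `T`, and every member containing `T` also contains an edge of `B` avoiding the
vertices of `T`. There are at most `k - #T` such edges, and at most `k - 2` when `#T = 1`. Growing
`T` from one edge to `s` edges, each edge lies in at most `(k - 2) (k - 2)ₛ₋₂ (2 (k - s) - 1)‼`
members, where `(n)ⱼ` is the falling factorial, so a smallest cover gives `s` times this as a bound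
on `#𝒜`. It is below `(2k - 3)‼` if `s < k`. If `s = k`, any member `B` is itself a smallest cover
and lies in the star of each of its `k` edges; counting it only once saves `k - 1`, which is needed
for `k = 3` and `k = 4`.
-/

namespace MatchingEKR

open Finset

section Cover

variable {β : Type*}

/-- A cover (transversal) of a family of finite sets: a set that meets every member. Families are
measured by the size of their smallest covers; those with a cover of size one are the stars. -/
def IsCover (C : Finset β) (𝒜 : Finset (Finset β)) : Prop :=
  ∀ A ∈ 𝒜, ¬ Disjoint A C

theorem exists_disjoint_of_card_lt {T : Finset β} {𝒜 : Finset (Finset β)}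
    (hT : ∀ C, IsCover C 𝒜 → #T < #C) : ∃ B ∈ 𝒜, Disjoint B T := by
  by_contra! h
  exact (hT T h).false

variable [DecidableEq β]

theorem IsCover.card_le_mul {C : Finset β} {𝒜 : Finset (Finset β)} (hC : IsCover C 𝒜) {b : ℕ}
    (hb : ∀ e ∈ C, #{A ∈ 𝒜 | e ∈ A} ≤ b) : #𝒜 ≤ #C * b := by
  have hsub : 𝒜 ⊆ C.biUnion fun e => {A ∈ 𝒜 | e ∈ A} := fun A hA => by
    obtain ⟨e, heA, heC⟩ := not_disjoint_iff.1 (hC A hA)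
    exact mem_biUnion.2 ⟨e, heC, mem_filter.2 ⟨hA, heA⟩⟩
  exact (card_le_card hsub).trans (card_biUnion_le_card_mul C _ b hb)

theorem card_le_card_mul_pred_add_one {𝒜 : Finset (Finset β)}
    (hint : (𝒜 : Set (Finset β)).Intersecting) {B : Finset β} (hB : B ∈ 𝒜) {b : ℕ}
    (hb : ∀ e, #{A ∈ 𝒜 | e ∈ A} ≤ b) : #𝒜 ≤ #B * (b - 1) + 1 := by
  have hcover : IsCover B (𝒜.erase B) := fun A hA => hint (mem_of_mem_erase hA) hB
  have hle : #(𝒜.erase B) ≤ #B * (b - 1) := hcover.card_le_mul fun e he => by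
    rw [filter_erase, card_erase_of_mem (mem_filter.2 ⟨hB, he⟩)]
    exact Nat.sub_le_sub_right (hb e) 1
  rw [← card_erase_add_one hB]
  exact Nat.add_le_add_right hle 1

end Cover

section Matching

variable {V : Type*} [DecidableEq V]

/-- The vertices covered by a set of edges. -/
def support (T : Finset (Sym2 V)) : Finset V :=
  T.biUnion Sym2.toFinset

@[simp]
theorem mem_support {T : Finset (Sym2 V)} {v : V} : v ∈ support T ↔ ∃ e ∈ T, v ∈ e := by
  simp [support]

/-- A matching of the complete graph on `V`, encoded as its set of edges. -/
structure IsMatching (M : Finset (Sym2 V)) : Prop where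
  not_isDiag : ∀ e ∈ M, ¬ e.IsDiag
  pairwiseDisjoint : (M : Set (Sym2 V)).PairwiseDisjoint Sym2.toFinset

namespace IsMatching

variable {M T : Finset (Sym2 V)}

theorem subset (hM : IsMatching M) (hTM : T ⊆ M) : IsMatching T :=
  ⟨fun e he => hM.not_isDiag e (hTM he), hM.pairwiseDisjoint.subset (coe_subset.2 hTM)⟩

theorem eq_of_mem (hM : IsMatching M) {e e' : Sym2 V} (he : e ∈ M) (he' : e' ∈ M) {v : V}
    (hv : v ∈ e) (hv' : v ∈ e') : e = e' :=
  hM.pairwiseDisjoint.elim_finset he he' v (Sym2.mem_toFinset.2 hv) (Sym2.mem_toFinset.2 hv')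

theorem eq_of_mk_mem (hM : IsMatching M) {a b c : V} (hb : s(a, b) ∈ M) (hc : s(a, c) ∈ M) :
    b = c :=
  Sym2.congr_right.1 (hM.eq_of_mem hb hc (Sym2.mem_mk_left a b) (Sym2.mem_mk_left a c))

theorem card_support (hM : IsMatching M) : #(support M) = 2 * #M := by
  rw [support, card_biUnion hM.pairwiseDisjoint,
    sum_const_nat fun e he => Sym2.card_toFinset_of_not_isDiag e (hM.not_isDiag e he), mul_comm]

theorem notMem_support (hM : IsMatching M) (hTM : T ⊆ M) {e : Sym2 V} (he : e ∈ M) (heT : e ∉ T)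
    {v : V} (hv : v ∈ e) : v ∉ support T := fun hvT => by
  obtain ⟨e', he', hv'⟩ := mem_support.1 hvT
  exact heT (hM.eq_of_mem (hTM he') he hv' hv ▸ he')

theorem insert_mk (hM : IsMatching M) {a b : V} (hab : a ≠ b) (ha : a ∉ support M)
    (hb : b ∉ support M) : IsMatching (insert s(a, b) M) where
  not_isDiag := by
    simpa only [forall_mem_insert, Sym2.mk_isDiag_iff] using ⟨hab, hM.not_isDiag⟩
  pairwiseDisjoint := by
    rw [coe_insert]
    refine hM.pairwiseDisjoint.insert fun e he _ => ?_
    have hae : a ∉ e := fun h => ha (mem_support.2 ⟨e, he, h⟩)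
    have hbe : b ∉ e := fun h => hb (mem_support.2 ⟨e, he, h⟩)
    simp [Sym2.toFinset_mk_eq, hae, hbe]

end IsMatching

/-- The edges of `B` that share no vertex with an edge of `T`. -/
def avoiding (B T : Finset (Sym2 V)) : Finset (Sym2 V) :=
  {e ∈ B | Disjoint e.toFinset (support T)}

@[simp]
theorem mem_avoiding {B T : Finset (Sym2 V)} {e : Sym2 V} :
    e ∈ avoiding B T ↔ e ∈ B ∧ ∀ v ∈ e, v ∉ support T := by
  simp only [avoiding, mem_filter, disjoint_left, Sym2.mem_toFinset]

variable [Fintype V]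

/-- A perfect matching of the complete graph on `V`, encoded as its set of edges. -/
structure IsPerfectMatching (M : Finset (Sym2 V)) : Prop extends IsMatching M where
  support_eq_univ : support M = univ

open scoped Classical in
variable (V) in
/-- The family of all perfect matchings of the complete graph on `V`. -/
noncomputable def perfectMatchings : Finset (Finset (Sym2 V)) :=
  {M | IsPerfectMatching M}

@[simp]
theorem mem_perfectMatchings {M : Finset (Sym2 V)} :
    M ∈ perfectMatchings V ↔ IsPerfectMatching M := by
  simp [perfectMatchings]

theorem IsMatching.card_avoiding_add_card_le {B T : Finset (Sym2 V)} (hB : IsMatching B)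
    (hT : IsMatching T) : 2 * (#(avoiding B T) + #T) ≤ Fintype.card V := by
  have hdisj : Disjoint (support (avoiding B T)) (support T) := disjoint_left.2 fun v hv => by
    obtain ⟨e, he, hve⟩ := mem_support.1 hv
    exact (mem_avoiding.1 he).2 v hve
  rw [mul_add, ← (hB.subset fun e he => (mem_avoiding.1 he).1).card_support, ← hT.card_support,
    ← card_union_of_disjoint hdisj]
  exact card_le_univ _

namespace IsPerfectMatching

variable {B M T : Finset (Sym2 V)}

theorem two_mul_card (hM : IsPerfectMatching M) : 2 * #M = Fintype.card V := by
  rw [← hM.card_support, hM.support_eq_univ, card_univ]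

theorem eq_of_subset (hT : IsPerfectMatching T) (hM : IsPerfectMatching M) (hTM : T ⊆ M) :
    T = M :=
  eq_of_subset_of_card_le hTM (by have := hT.two_mul_card; have := hM.two_mul_card; omega)

theorem exists_mk_mem (hM : IsPerfectMatching M) (v : V) : ∃ w, s(v, w) ∈ M := by
  obtain ⟨e, he, w, rfl⟩ := mem_support.1 (hM.support_eq_univ ▸ mem_univ v)
  exact ⟨w, he⟩

/-- Two edges of `B` are lost: the ones at the two ends of `e`. -/
theorem card_avoiding_singleton_add_two_le (hB : IsPerfectMatching B) {e : Sym2 V}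
    (hdiag : ¬ e.IsDiag) (he : e ∉ B) : #(avoiding B {e}) + 2 ≤ #B := by
  induction e with | _ a b
  obtain ⟨c, hc⟩ := hB.exists_mk_mem a
  obtain ⟨d, hd⟩ := hB.exists_mk_mem b
  have hne : s(a, c) ≠ s(b, d) := fun h => by
    have hb : b ∈ s(a, c) := h ▸ Sym2.mem_mk_left b d
    exact he ((Sym2.mem_and_mem_iff hdiag).1 ⟨Sym2.mem_mk_left a c, hb⟩ ▸ hc)
  have hsub : avoiding B {s(a, b)} ⊆ B \ {s(a, c), s(b, d)} := fun f hf => by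
    obtain ⟨hfB, hf⟩ := mem_avoiding.1 hf
    have haf : a ∉ f := fun h => hf a h (by simp)
    have hbf : b ∉ f := fun h => hf b h (by simp)
    simp only [mem_sdiff, mem_insert, mem_singleton, not_or]
    exact ⟨hfB, fun h => haf (h ▸ Sym2.mem_mk_left a c), fun h => hbf (h ▸ Sym2.mem_mk_left b d)⟩
  have hpair : {s(a, c), s(b, d)} ⊆ B := by simp [insert_subset_iff, hc, hd]
  calc #(avoiding B {s(a, b)}) + 2 ≤ #(B \ {s(a, c), s(b, d)}) + #{s(a, c), s(b, d)} := by
        rw [card_pair hne]; gcongr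
    _ = #B := card_sdiff_add_card_eq_card hpair

end IsPerfectMatching

theorem filter_perfectMatchings_eq_biUnion {T : Finset (Sym2 V)} {a : V} (ha : a ∉ support T) :
    {M ∈ perfectMatchings V | T ⊆ M} =
      (insert a (support T))ᶜ.biUnion fun b => {M ∈ perfectMatchings V | insert s(a, b) T ⊆ M} := by
  ext M
  simp only [mem_filter, mem_biUnion, mem_compl, mem_insert, insert_subset_iff,
    mem_perfectMatchings, not_or]
  refine ⟨fun ⟨hM, hTM⟩ => ?_, fun ⟨_, _, hM, _, hTM⟩ => ⟨hM, hTM⟩⟩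
  obtain ⟨b, hb⟩ := hM.exists_mk_mem a
  have hbT : s(a, b) ∉ T := fun h => ha (mem_support.2 ⟨_, h, Sym2.mem_mk_left a b⟩)
  have hba : b ≠ a := fun h => hM.not_isDiag _ hb h.symm
  exact ⟨b, ⟨hba, hM.notMem_support hTM hb hbT (Sym2.mem_mk_right a b)⟩, hM, hb, hTM⟩

theorem IsMatching.card_filter_perfectMatchings {T : Finset (Sym2 V)} (hT : IsMatching T) {m : ℕ}
    (hm : Fintype.card V = 2 * (#T + m)) :
    #{M ∈ perfectMatchings V | T ⊆ M} = (2 * m - 1)‼ := by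
  induction m generalizing T with
  | zero =>
    have hTperf : IsPerfectMatching T :=
      ⟨hT, (card_eq_iff_eq_univ _).1 (by rw [hT.card_support, hm, add_zero])⟩
    have hsingle : {M ∈ perfectMatchings V | T ⊆ M} = {T} := by
      ext M
      simp only [mem_filter, mem_perfectMatchings, mem_singleton]
      exact ⟨fun ⟨hM, hTM⟩ => (hTperf.eq_of_subset hM hTM).symm,
        fun h => h.symm ▸ ⟨hTperf, Subset.rfl⟩⟩
    rw [hsingle, card_singleton, mul_zero, Nat.zero_sub, Nat.doubleFactorial]
  | succ m ih =>
    obtain ⟨a, ha⟩ : ∃ a, a ∉ support T := by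
      by_contra! h
      have := (card_eq_iff_eq_univ _).2 (eq_univ_of_forall h)
      rw [hT.card_support] at this
      omega
    have hdisj : (((insert a (support T))ᶜ : Finset V) : Set V).PairwiseDisjoint fun b =>
        {M ∈ perfectMatchings V | insert s(a, b) T ⊆ M} := by
      refine fun b _ c _ hbc => disjoint_left.2 fun M hMb hMc => hbc ?_
      simp only [mem_filter, mem_perfectMatchings, insert_subset_iff] at hMb hMc
      exact hMb.1.eq_of_mk_mem hMb.2.1 hMc.2.1
    have hfiber : ∀ b ∈ (insert a (support T))ᶜ,
        #{M ∈ perfectMatchings V | insert s(a, b) T ⊆ M} = (2 * m - 1)‼ := fun b hb => by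
      simp only [mem_compl, mem_insert, not_or] at hb
      refine ih (hT.insert_mk (Ne.symm hb.1) ha hb.2) ?_
      rw [card_insert_of_notMem fun h => ha (mem_support.2 ⟨_, h, Sym2.mem_mk_left a b⟩), hm]
      ring
    have hcard : #(insert a (support T))ᶜ = 2 * m + 1 := by
      rw [card_compl, card_insert_of_notMem ha, hT.card_support]
      omega
    rw [filter_perfectMatchings_eq_biUnion ha, card_biUnion hdisj, sum_const_nat hfiber, hcard]
    exact (Nat.doubleFactorial_add_one (2 * m)).symm

section Intersecting

variable {k : ℕ} {𝒜 : Finset (Finset (Sym2 V))}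

theorem card_filter_superset_le (h𝒜 : 𝒜 ⊆ perfectMatchings V) (hV : Fintype.card V = 2 * k)
    (T : Finset (Sym2 V)) : #{A ∈ 𝒜 | T ⊆ A} ≤ (2 * (k - #T) - 1)‼ := by
  obtain hempty | ⟨A, hA⟩ := {A ∈ 𝒜 | T ⊆ A}.eq_empty_or_nonempty
  · simp [hempty]
  obtain ⟨hA, hTA⟩ := mem_filter.1 hA
  have hA := mem_perfectMatchings.1 (h𝒜 hA)
  have hcard : #T ≤ k := (card_le_card hTA).trans (by have := hA.two_mul_card; omega)
  rw [← (hA.subset hTA).card_filter_perfectMatchings (m := k - #T) (by omega)]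
  exact card_le_card (filter_subset_filter _ h𝒜)

/-- A member of `𝒜` that contains `T` meets `B` outside `T`, and does so in an edge avoiding the
vertices of `T`. -/
theorem isCover_avoiding (h𝒜 : 𝒜 ⊆ perfectMatchings V)
    (hint : (𝒜 : Set (Finset (Sym2 V))).Intersecting) {B T : Finset (Sym2 V)} (hB : B ∈ 𝒜)
    (hBT : Disjoint B T) : IsCover (avoiding B T) {A ∈ 𝒜 | T ⊆ A} := fun A hA => by
  obtain ⟨hA, hTA⟩ := mem_filter.1 hA
  obtain ⟨e, heA, heB⟩ := not_disjoint_iff.1 (hint hA hB)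
  have heT : e ∉ T := disjoint_left.1 hBT heB
  have hM : IsMatching A := (mem_perfectMatchings.1 (h𝒜 hA)).toIsMatching
  exact not_disjoint_iff.2
    ⟨e, heA, mem_avoiding.2 ⟨heB, fun v hv => hM.notMem_support hTA heA heT hv⟩⟩

theorem card_filter_superset_le_card_avoiding_mul (h𝒜 : 𝒜 ⊆ perfectMatchings V)
    (hint : (𝒜 : Set (Finset (Sym2 V))).Intersecting) {B T : Finset (Sym2 V)} (hB : B ∈ 𝒜)
    (hBT : Disjoint B T) {b : ℕ} (hb : ∀ e ∉ T, #{A ∈ 𝒜 | insert e T ⊆ A} ≤ b) :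
    #{A ∈ 𝒜 | T ⊆ A} ≤ #(avoiding B T) * b := by
  refine (isCover_avoiding h𝒜 hint hB hBT).card_le_mul fun e he => ?_
  have heT : e ∉ T := disjoint_left.1 hBT (mem_avoiding.1 he).1
  simpa only [filter_filter, insert_subset_iff, and_comm] using hb e heT

theorem card_filter_superset_le_descFactorial (h𝒜 : 𝒜 ⊆ perfectMatchings V)
    (hint : (𝒜 : Set (Finset (Sym2 V))).Intersecting) (hV : Fintype.card V = 2 * k) {j : ℕ}
    {T : Finset (Sym2 V)} (hcov : ∀ C, IsCover C 𝒜 → #T + j ≤ #C) :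
    #{A ∈ 𝒜 | T ⊆ A} ≤ (k - #T).descFactorial j * (2 * (k - #T - j) - 1)‼ := by
  induction j generalizing T with
  | zero => simpa using card_filter_superset_le h𝒜 hV T
  | succ j ih =>
    obtain hempty | ⟨A, hA⟩ := {A ∈ 𝒜 | T ⊆ A}.eq_empty_or_nonempty
    · simp [hempty]
    obtain ⟨hA, hTA⟩ := mem_filter.1 hA
    obtain ⟨B, hB, hBT⟩ := exists_disjoint_of_card_lt fun C hC =>
      (Nat.lt_add_of_pos_right j.succ_pos).trans_le (hcov C hC)
    have havoid : #(avoiding B T) ≤ k - #T := by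
      have := (mem_perfectMatchings.1 (h𝒜 hB)).card_avoiding_add_card_le
        ((mem_perfectMatchings.1 (h𝒜 hA)).subset hTA)
      omega
    have hinsert : ∀ e ∉ T, #{A ∈ 𝒜 | insert e T ⊆ A} ≤
        (k - #T - 1).descFactorial j * (2 * (k - #T - (j + 1)) - 1)‼ := fun e he => by
      have hcard := card_insert_of_notMem he
      have := ih (T := insert e T) fun C hC => by have := hcov C hC; omega
      rwa [hcard, ← Nat.sub_sub k, Nat.sub_right_comm _ 1 j, Nat.sub_sub _ j 1] at this
    calc #{A ∈ 𝒜 | T ⊆ A}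
        ≤ #(avoiding B T) * ((k - #T - 1).descFactorial j * (2 * (k - #T - (j + 1)) - 1)‼) :=
          card_filter_superset_le_card_avoiding_mul h𝒜 hint hB hBT hinsert
      _ ≤ (k - #T) * ((k - #T - 1).descFactorial j * (2 * (k - #T - (j + 1)) - 1)‼) := by gcongr
      _ = (k - #T).descFactorial (j + 1) * (2 * (k - #T - (j + 1)) - 1)‼ := by
          rw [← mul_assoc]
          cases k - #T with
          | zero => simp
          | succ n => rw [Nat.succ_descFactorial_succ, Nat.succ_sub_one]

theorem card_filter_mem_le (h𝒜 : 𝒜 ⊆ perfectMatchings V)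
    (hint : (𝒜 : Set (Finset (Sym2 V))).Intersecting) {n j : ℕ}
    (hV : Fintype.card V = 2 * (n + 2)) (hcov : ∀ C, IsCover C 𝒜 → j + 2 ≤ #C) (e : Sym2 V) :
    #{A ∈ 𝒜 | e ∈ A} ≤ n * (n.descFactorial j * (2 * (n - j) - 1)‼) := by
  obtain hempty | ⟨A, hA⟩ := {A ∈ 𝒜 | e ∈ A}.eq_empty_or_nonempty
  · simp [hempty]
  obtain ⟨hA, heA⟩ := mem_filter.1 hA
  obtain ⟨B, hB, hBe⟩ := exists_disjoint_of_card_lt (T := {e}) fun C hC => by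
    have := hcov C hC
    rw [card_singleton]
    omega
  have havoid : #(avoiding B {e}) ≤ n := by
    have hBperf := mem_perfectMatchings.1 (h𝒜 hB)
    have hdiag := (mem_perfectMatchings.1 (h𝒜 hA)).not_isDiag e heA
    have := hBperf.card_avoiding_singleton_add_two_le hdiag (disjoint_singleton_right.1 hBe)
    have := hBperf.two_mul_card
    omega
  have hinsert : ∀ f ∉ ({e} : Finset (Sym2 V)), #{A ∈ 𝒜 | insert f {e} ⊆ A} ≤
      n.descFactorial j * (2 * (n - j) - 1)‼ := fun f hf => by
    have hcard : #(insert f {e}) = 2 := by rw [card_insert_of_notMem hf, card_singleton]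
    simpa only [hcard, Nat.add_sub_cancel] using
      card_filter_superset_le_descFactorial (T := insert f {e}) h𝒜 hint hV fun C hC => by
        have := hcov C hC; omega
  calc #{A ∈ 𝒜 | e ∈ A} = #{A ∈ 𝒜 | {e} ⊆ A} := by simp only [singleton_subset_iff]
    _ ≤ #(avoiding B {e}) * (n.descFactorial j * (2 * (n - j) - 1)‼) :=
        card_filter_superset_le_card_avoiding_mul h𝒜 hint hB hBe hinsert
    _ ≤ n * (n.descFactorial j * (2 * (n - j) - 1)‼) := by gcongr

end Intersecting

end Matching

section Estimates

theorem mul_descFactorial_mul_doubleFactorial_lt {j n : ℕ} (hj : j < n) :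
    (j + 2) * (n * (n.descFactorial j * (2 * (n - j) - 1)‼)) < (2 * n + 1)‼ := by
  induction j with
  | zero =>
    obtain ⟨n, rfl⟩ := Nat.exists_eq_add_one.2 hj
    have : 0 < (2 * n + 1)‼ := Nat.doubleFactorial_pos _
    calc (0 + 2) * ((n + 1) * ((n + 1).descFactorial 0 * (2 * (n + 1) - 1)‼))
        = (2 * n + 2) * (2 * n + 1)‼ := by
          rw [Nat.descFactorial_zero, show 2 * (n + 1) - 1 = 2 * n + 1 by omega]; ring
      _ < (2 * n + 3) * (2 * n + 1)‼ := by gcongr; omega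
      _ = (2 * (n + 1) + 1)‼ := rfl
  | succ j ih =>
    obtain ⟨r, rfl⟩ := Nat.exists_eq_add_of_lt hj
    set n := j + 1 + r + 1
    have hr : n - j = r + 2 := by omega
    have hr' : n - (j + 1) = r + 1 := by omega
    refine lt_of_le_of_lt ?_ (ih (by omega))
    calc (j + 1 + 2) * (n * (n.descFactorial (j + 1) * (2 * (n - (j + 1)) - 1)‼))
        = (j + 3) * (r + 2) * (n * n.descFactorial j * (2 * r + 1)‼) := by
          rw [Nat.descFactorial_succ, hr, hr', show 2 * (r + 1) - 1 = 2 * r + 1 by omega]; ring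
      _ ≤ (j + 2) * (2 * r + 3) * (n * n.descFactorial j * (2 * r + 1)‼) :=
          Nat.mul_le_mul_right _ (by nlinarith)
      _ = (j + 2) * (n * (n.descFactorial j * (2 * (n - j) - 1)‼)) := by
          rw [hr, show 2 * (r + 2) - 1 = 2 * r + 1 + 2 by omega, Nat.doubleFactorial]; ring

theorem mul_mul_factorial_lt_doubleFactorial {n : ℕ} (hn : 3 ≤ n) :
    (n + 2) * (n * n.factorial) < (2 * n + 1)‼ := by
  induction n, hn using Nat.le_induction with
  | base => decide
  | succ n hn ih =>
    have hratio : (n + 3) * (n + 1) ^ 2 ≤ (n + 2) * n * (2 * n + 3) := by nlinarith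
    refine lt_of_mul_lt_mul_left (a := (n + 2) * n) ?_ (Nat.zero_le _)
    calc (n + 2) * n * ((n + 1 + 2) * ((n + 1) * (n + 1).factorial))
        = (n + 3) * (n + 1) ^ 2 * ((n + 2) * (n * n.factorial)) := by rw [Nat.factorial_succ]; ring
      _ ≤ (n + 2) * n * (2 * n + 3) * ((n + 2) * (n * n.factorial)) := by gcongr
      _ < (n + 2) * n * (2 * n + 3) * (2 * n + 1)‼ := by gcongr
      _ = (n + 2) * n * (2 * (n + 1) + 1)‼ := mul_assoc _ _ _

theorem mul_pred_add_one_lt_doubleFactorial {n : ℕ} (hn : 1 ≤ n) :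
    (n + 2) * (n * n.factorial - 1) + 1 < (2 * n + 1)‼ := by
  obtain hn3 | hn3 := lt_or_ge n 3
  · interval_cases n <;> decide
  · have hpos : 0 < n * n.factorial := Nat.mul_pos hn n.factorial_pos
    have := mul_mul_factorial_lt_doubleFactorial hn3
    rw [Nat.mul_sub_one]
    have : n + 2 ≤ (n + 2) * (n * n.factorial) := Nat.le_mul_of_pos_right _ hpos
    omega

end Estimates

section Extremal

variable {V : Type*} [DecidableEq V] [Fintype V]

theorem card_lt_of_forall_isCover_two_le {𝒜 : Finset (Finset (Sym2 V))}
    (h𝒜 : 𝒜 ⊆ perfectMatchings V) (hint : (𝒜 : Set (Finset (Sym2 V))).Intersecting) {k : ℕ}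
    (hV : Fintype.card V = 2 * k) (hcov : ∀ C, IsCover C 𝒜 → 2 ≤ #C) :
    #𝒜 < (2 * k - 3)‼ := by
  obtain ⟨B, hB, -⟩ := exists_disjoint_of_card_lt (T := ∅) fun C hC =>
    two_pos.trans_le (hcov C hC)
  have hBcard : #B = k := by
    have := (mem_perfectMatchings.1 (h𝒜 hB)).two_mul_card
    omega
  have hBcov : IsCover B 𝒜 := fun A hA => hint hA hB
  obtain ⟨C, hC, hmin⟩ := exists_minimalFor_of_wellFoundedLT (IsCover · 𝒜) card ⟨B, hBcov⟩
  have hmin : ∀ D, IsCover D 𝒜 → #C ≤ #D := fun D hD =>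
    (le_total #C #D).elim id fun h => hmin hD h
  obtain ⟨j, hj⟩ := Nat.exists_eq_add_of_le' (hcov C hC)
  obtain ⟨n, rfl⟩ := Nat.exists_eq_add_of_le' (hBcard ▸ hcov B hBcov)
  have hjn : j ≤ n := by have := hmin B hBcov; omega
  have hlink := card_filter_mem_le h𝒜 hint hV (j := j) fun D hD => hj ▸ hmin D hD
  have hstar : 2 * (n + 2) - 3 = 2 * n + 1 := by omega
  rw [hstar]
  obtain hlt | rfl := hjn.lt_or_eq
  · exact (hj ▸ hC.card_le_mul fun e _ => hlink e).trans_lt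
      (mul_descFactorial_mul_doubleFactorial_lt hlt)
  · have hlink : ∀ e, #{A ∈ 𝒜 | e ∈ A} ≤ j * j.factorial := by
      simpa [Nat.descFactorial_self] using hlink
    have hpos : 1 ≤ j := Nat.one_le_iff_ne_zero.2 fun h => by
      have hle := hC.card_le_mul fun e _ => hlink e
      rw [h, zero_mul, mul_zero] at hle
      exact hle.not_gt (card_pos.2 ⟨B, hB⟩)
    exact (hBcard ▸ card_le_card_mul_pred_add_one hint hB hlink).trans_lt
      (mul_pred_add_one_lt_doubleFactorial hpos)

theorem card_lt_or_exists_forall_mem {𝒜 : Finset (Finset (Sym2 V))}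
    (h𝒜 : 𝒜 ⊆ perfectMatchings V) (hint : (𝒜 : Set (Finset (Sym2 V))).Intersecting) {k : ℕ}
    (hV : Fintype.card V = 2 * k) :
    #𝒜 < (2 * k - 3)‼ ∨ ∃ e, ¬ e.IsDiag ∧ ∀ A ∈ 𝒜, e ∈ A := by
  obtain rfl | ⟨B, hB⟩ := 𝒜.eq_empty_or_nonempty
  · exact Or.inl (by simpa using Nat.doubleFactorial_pos _)
  refine or_iff_not_imp_right.2 fun hstar => ?_
  push Not at hstar
  refine card_lt_of_forall_isCover_two_le h𝒜 hint hV fun C hC => ?_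
  obtain ⟨e, heB, heC⟩ := not_disjoint_iff.1 (hC B hB)
  obtain ⟨A, hA, heA⟩ := hstar e ((mem_perfectMatchings.1 (h𝒜 hB)).not_isDiag e heB)
  obtain ⟨f, hfA, hfC⟩ := not_disjoint_iff.1 (hC A hA)
  exact one_lt_card.2 ⟨e, heC, f, hfC, fun h => heA (h ▸ hfA)⟩

end Extremal

section PerfectMatching

theorem isPerfectMatching_toFinset_edgeSet {V : Type*} [DecidableEq V] [Fintype V]
    {G : SimpleGraph V} {M : G.Subgraph} (hM : M.IsPerfectMatching) :
    IsPerfectMatching (Set.toFinite M.edgeSet).toFinset where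
  not_isDiag e he :=
    G.not_isDiag_of_mem_edgeSet (M.edgeSet_subset ((Set.Finite.mem_toFinset _).1 he))
  pairwiseDisjoint e he f hf hef := disjoint_left.2 fun v hve hvf => hef <| by
    obtain ⟨a, rfl⟩ := Sym2.mem_toFinset.1 hve
    obtain ⟨b, rfl⟩ := Sym2.mem_toFinset.1 hvf
    rw [Set.Finite.coe_toFinset] at he hf
    exact Sym2.congr_right.2 (hM.1.eq_of_adj_left he hf)
  support_eq_univ := eq_univ_of_forall fun v => by
    obtain ⟨w, hvw, -⟩ := SimpleGraph.Subgraph.isPerfectMatching_iff.1 hM v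
    exact mem_support.2 ⟨s(v, w), (Set.Finite.mem_toFinset _).2 hvw, Sym2.mem_mk_left v w⟩

variable {k : ℕ}

/-- The edge set of a perfect matching, passing from the subgraph encoding `PM` to the encoding
by sets of edges. -/
noncomputable def PM.edges (M : PM k) : Finset (Sym2 (Fin (2 * k))) :=
  (Set.toFinite M.1.edgeSet).toFinset

@[simp]
theorem PM.mem_edges {M : PM k} {e : Sym2 (Fin (2 * k))} : e ∈ M.edges ↔ e ∈ M.1.edgeSet :=
  Set.Finite.mem_toFinset _

theorem PM.edges_injective : Function.Injective (PM.edges (k := k)) := fun M N hMN => by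
  refine Subtype.ext (SimpleGraph.Subgraph.ext ?_ ?_)
  · rw [M.2.2.verts_eq_univ, N.2.2.verts_eq_univ]
  · ext x y
    rw [← SimpleGraph.Subgraph.mem_edgeSet, ← mem_edges, hMN, mem_edges,
      SimpleGraph.Subgraph.mem_edgeSet]

theorem PM.exists_edges_eq {P : Finset (Sym2 (Fin (2 * k)))} (hP : IsPerfectMatching P) :
    ∃ M : PM k, M.edges = P := by
  let M : (⊤ : SimpleGraph (Fin (2 * k))).Subgraph :=
    SimpleGraph.toSubgraph (SimpleGraph.fromEdgeSet (P : Set (Sym2 (Fin (2 * k))))) le_top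
  have hadj : ∀ x y, M.Adj x y ↔ s(x, y) ∈ P := fun x y => by
    simpa [M] using fun h : s(x, y) ∈ P => hP.not_isDiag _ h
  have hM : M.IsPerfectMatching := SimpleGraph.Subgraph.isPerfectMatching_iff.2 fun x => by
    obtain ⟨y, hy⟩ := hP.exists_mk_mem x
    exact ⟨y, (hadj x y).2 hy, fun z hz => hP.eq_of_mk_mem ((hadj x z).1 hz) hy⟩
  refine ⟨⟨M, hM⟩, ext fun e => ?_⟩
  induction e with | _ x y
  exact PM.mem_edges.trans (hadj x y)

theorem PM.image_edges_canonical (e : Sym2 (Fin (2 * k))) :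
    PM.edges '' canonical e = ({P ∈ perfectMatchings (Fin (2 * k)) | e ∈ P} : Finset _) := by
  ext P
  simp only [Set.mem_image, coe_filter, mem_perfectMatchings, Set.mem_ofPred_eq]
  constructor
  · rintro ⟨M, hM, rfl⟩
    exact ⟨isPerfectMatching_toFinset_edgeSet M.2, mem_edges.2 hM⟩
  · rintro ⟨hP, he⟩
    obtain ⟨M, rfl⟩ := exists_edges_eq hP
    exact ⟨M, mem_edges.1 he, rfl⟩

theorem ncard_canonical {e : Sym2 (Fin (2 * k))}
    (he : e ∈ (⊤ : SimpleGraph (Fin (2 * k))).edgeSet) :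
    (canonical e).ncard = (2 * k - 3)‼ := by
  induction e with | _ a b
  have hsingle : IsMatching {s(a, b)} :=
    (⟨by simp, by simp⟩ : IsMatching ∅).insert_mk (by simpa using he) (by simp) (by simp)
  have hcard := hsingle.card_filter_perfectMatchings (m := k - 1) (by
    have := a.pos
    rw [Fintype.card_fin, card_singleton]
    omega)
  simp only [singleton_subset_iff] at hcard
  rw [← Set.ncard_image_of_injective _ PM.edges_injective, PM.image_edges_canonical,
    Set.ncard_coe_finset, hcard]
  congr 1
  omega

theorem isIntersecting_canonical (e : Sym2 (Fin (2 * k))) : IsIntersecting (canonical e) :=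
  fun _ hM _ hN _ => ⟨e, hM, hN⟩

theorem IsIntersecting.intersecting_image_edges (hk : 1 ≤ k) {F : Set (PM k)}
    (hF : IsIntersecting F) : (PM.edges '' F).Intersecting := by
  rintro _ ⟨M, hM, rfl⟩ _ ⟨N, hN, rfl⟩
  obtain rfl | hMN := eq_or_ne M N
  · obtain ⟨w, hw⟩ := (isPerfectMatching_toFinset_edgeSet M.2).exists_mk_mem ⟨0, by omega⟩
    exact not_disjoint_iff.2 ⟨_, hw, hw⟩
  · obtain ⟨e, heM, heN⟩ := hF hM hN hMN
    exact not_disjoint_iff.2 ⟨e, PM.mem_edges.2 heM, PM.mem_edges.2 heN⟩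

theorem IsIntersecting.ncard_lt_or_subset_canonical (hk : 1 ≤ k) {F : Set (PM k)}
    (hF : IsIntersecting F) :
    F.ncard < (2 * k - 3)‼ ∨
      ∃ e ∈ (⊤ : SimpleGraph (Fin (2 * k))).edgeSet, F ⊆ canonical e := by
  obtain ⟨𝒜, h𝒜⟩ := (Set.toFinite (PM.edges '' F)).exists_finset_coe
  have hsub : 𝒜 ⊆ perfectMatchings (Fin (2 * k)) := fun A hA => by
    obtain ⟨M, -, rfl⟩ := (Set.ext_iff.1 h𝒜 A).1 hA
    exact mem_perfectMatchings.2 (isPerfectMatching_toFinset_edgeSet M.2)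
  have hcard : #𝒜 = F.ncard := by
    rw [← Set.ncard_coe_finset, h𝒜, Set.ncard_image_of_injective _ PM.edges_injective]
  have hint := h𝒜 ▸ hF.intersecting_image_edges hk
  rw [← hcard]
  refine (card_lt_or_exists_forall_mem hsub hint (Fintype.card_fin _)).imp_right ?_
  rintro ⟨e, hdiag, he⟩
  refine ⟨e, by simpa using hdiag, fun M hM => PM.mem_edges.1 (he _ ?_)⟩
  exact (Set.ext_iff.1 h𝒜 _).2 ⟨M, hM, rfl⟩

theorem IsIntersecting.ncard_le (hk : 1 ≤ k) {F : Set (PM k)} (hF : IsIntersecting F) :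
    F.ncard ≤ (2 * k - 3)‼ := by
  obtain hlt | ⟨e, he, hsub⟩ := hF.ncard_lt_or_subset_canonical hk
  · exact hlt.le
  · exact (Set.ncard_le_ncard hsub).trans_eq (ncard_canonical he)

theorem isIntersecting_and_ncard_eq_iff (hk : 1 ≤ k) {F : Set (PM k)} :
    (IsIntersecting F ∧ F.ncard = (2 * k - 3)‼) ↔
      ∃ e ∈ (⊤ : SimpleGraph (Fin (2 * k))).edgeSet, F = canonical e := by
  constructor
  · rintro ⟨hF, hcard⟩
    obtain hlt | ⟨e, he, hsub⟩ := hF.ncard_lt_or_subset_canonical hk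
    · exact absurd hcard hlt.ne
    · exact ⟨e, he, Set.eq_of_subset_of_ncard_le hsub (by rw [ncard_canonical he, hcard])⟩
  · rintro ⟨e, he, rfl⟩
    exact ⟨isIntersecting_canonical e, ncard_canonical he⟩

end PerfectMatching

section Coclique

theorem isMaximumIndepSet_iff_card_eq_indepNum {V : Type*} [Finite V] {G : SimpleGraph V}
    {F : Finset V} :
    G.IsMaximumIndepSet F ↔ G.IsIndepSet (F : Set V) ∧ #F = G.indepNum :=
  ⟨fun h => ⟨h.isIndepSet, G.maximumIndepSet_card_eq_indepNum F h⟩,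
    fun ⟨hF, hcard⟩ => ⟨hF, fun _ hE => hcard ▸ hE.card_le_indepNum⟩⟩

variable {k : ℕ}

theorem isIndepSet_derangementGraph_iff {F : Set (PM k)} :
    (derangementGraph k).IsIndepSet F ↔ IsIntersecting F :=
  forall₅_congr fun M _ N _ hMN => by simp [derangementGraph, hMN]

theorem indepNum_derangementGraph (hk : 1 ≤ k) :
    (derangementGraph k).indepNum = (2 * k - 3)‼ := by
  apply le_antisymm
  · obtain ⟨F, hF⟩ := (derangementGraph k).exists_isNIndepSet_indepNum
    rw [← hF.card_eq, ← Set.ncard_coe_finset]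
    exact (isIndepSet_derangementGraph_iff.1 hF.isIndepSet).ncard_le hk
  · let e : Sym2 (Fin (2 * k)) := s(⟨0, by omega⟩, ⟨1, by omega⟩)
    obtain ⟨F, hF⟩ := (Set.toFinite (canonical e)).exists_finset_coe
    rw [← ncard_canonical (e := e) (by simp [e]), ← hF, Set.ncard_coe_finset]
    refine SimpleGraph.IsIndepSet.card_le_indepNum ?_
    rw [isIndepSet_derangementGraph_iff, hF]
    exact isIntersecting_canonical e

theorem isMaximumIndepSet_derangementGraph_iff (hk : 1 ≤ k) {F : Finset (PM k)} :
    (derangementGraph k).IsMaximumIndepSet F ↔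
      ∃ e ∈ (⊤ : SimpleGraph (Fin (2 * k))).edgeSet, (F : Set (PM k)) = canonical e := by
  rw [isMaximumIndepSet_iff_card_eq_indepNum, isIndepSet_derangementGraph_iff,
    indepNum_derangementGraph hk, ← Set.ncard_coe_finset, isIntersecting_and_ncard_eq_iff hk]

end Coclique

end MatchingEKR

theorem mainTheorem1 (k : ℕ) (hk : 1 ≤ k) :
    -- the bound; for `k = 1` the expression `(2 * k - 3)‼` is `0‼ = 1 = (-1)‼`
    (∀ F : Set (MatchingEKR.PM k), MatchingEKR.IsIntersecting F → F.ncard ≤ (2 * k - 3)‼) ∧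
    -- equality holds exactly for the canonically intersecting families
    (∀ F : Set (MatchingEKR.PM k),
      (MatchingEKR.IsIntersecting F ∧ F.ncard = (2 * k - 3)‼) ↔
        ∃ e ∈ (⊤ : SimpleGraph (Fin (2 * k))).edgeSet, F = MatchingEKR.canonical e) ∧
    -- the same in terms of cocliques of the derangement graph
    (MatchingEKR.derangementGraph k).indepNum = (2 * k - 3)‼ ∧
    (∀ F : Finset (MatchingEKR.PM k),
      (MatchingEKR.derangementGraph k).IsMaximumIndepSet F ↔
        ∃ e ∈ (⊤ : SimpleGraph (Fin (2 * k))).edgeSet,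
          (F : Set (MatchingEKR.PM k)) = MatchingEKR.canonical e) := by
  exact ⟨fun _ hF => hF.ncard_le hk,
    fun _ => MatchingEKR.isIntersecting_and_ncard_eq_iff hk,
    MatchingEKR.indepNum_derangementGraph hk,
    fun _ => MatchingEKR.isMaximumIndepSet_derangementGraph_iff hk⟩
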